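/- All graphs are finite and loopless, and may have parallel edges. For a graph $G$ and a vertex set $S\subseteq V(G)$ let $d(S)$ be the number of edges with exactly one end in $S$, and let $d(v)$ be the degree of a vertex $v$. The multiplicity $\mu(G)$ is the maximum number of parallel edges joining two distinct vertices, $\delta(G)$ is the minimum degree and $e(G)$ is the number of edges. For an integer $\ell\ge 1$, a $\mathbb{Z}_{2\ell}$-boundary of $G$ is a map $\beta\colon V(G)\to\{0,1,\dots,2\ell-1\}$ with $\beta(v)\equiv d(v)\pmod 2$ for every vertex $v$ and $\sum_{v\in V(G)}\beta(v)\equiv 0\pmod{2\ell}$. A $\beta$-orientation is an orientation $D$ of $G$ with $d_D^+(v)-d_D^-(v)\equiv\beta(v)\pmod{2\ell}$ for every vertex $v$, where $d_D^+(v)$ and $d_D^-(v)$ are the numbers of arcs with tail $v$ and with head $v$. The graph $G$ is strongly $\mathbb{Z}_\ell$-connected if it has a $\beta$-orientation for every $\mathbb{Z}_{2\ell}$-boundary $\beta$ of $G$. Theorem. Let $\ell\ge 3$ be an integer and let $G$ be a graph with exactly $4$ vertices, $e(G)=3\ell-3$, $\mu(G)\le \ell-2$ and $\delta(G)\ge \ell-1$.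 Then $G$ is not strongly $\mathbb{Z}_\ell$-connected if and only if both of the following hold: (1) $d(S)=2\ell-2$ for every $S\subseteq V(G)$ with $|S|=2$; (2) $d(v)\equiv \ell\pmod 2$ for every $v\in V(G)$. Moreover, in this case the constant map $\beta=(\ell,\ell,\ell,\ell)$ is a $\mathbb{Z}_{2\ell}$-boundary of $G$, and it is the only $\mathbb{Z}_{2\ell}$-boundary $\beta$ of $G$ for which $G$ has no $\beta$-orientation. -/

import Mathlib

open scoped Graph

namespace Graph

variable {α β : Type*}

/-- The degree of a vertex: the number of incident edges, a loop being counted twice. -/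
noncomputable def deg (G : Graph α β) (v : α) : ℕ :=
  (G.incidenceSet v).ncard + (G.loopSet v).ncard

/-- The minimum degree `δ(G)` of a finite graph with at least one vertex. -/
noncomputable def minDeg (G : Graph α β) : ℕ :=
  sInf {d : ℕ | ∃ v ∈ V(G), d = G.deg v}

/-- The number of parallel edges joining `x` and `y`. -/
noncomputable def edgeMult (G : Graph α β) (x y : α) : ℕ :=
  {e : β | G.IsLink e x y}.ncard

/-- The multiplicity of a finite graph: the largest number of parallel edges that join
two distinct vertices. -/
noncomputable def maxMult (G : Graph α β) : ℕ :=
  sSup {m : ℕ | ∃ x ∈ V(G), ∃ y ∈ V(G), x ≠ y ∧ m = G.edgeMult x y}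

/-- The degree `d(S)` of a vertex set: the number of edges with one end in `S` and the other
end in the complement `V(G) \ S`. -/
noncomputable def cutDeg (G : Graph α β) (S : Set α) : ℕ :=
  {e : β | ∃ x ∈ S, ∃ y ∈ V(G) \ S, G.IsLink e x y}.ncard

/-- An orientation of `G`: every edge gets one of its ends as tail and the other as head. -/
structure EdgeOrientation (G : Graph α β) where
  tail : E(G) → α
  head : E(G) → α
  isLink : ∀ e : E(G), G.IsLink e (tail e) (head e)

/-- The number of arcs with tail `v`. -/
noncomputable def EdgeOrientation.outDeg {G : Graph α β} (D : G.EdgeOrientation) (v : α) : ℕ :=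
  {e : E(G) | D.tail e = v}.ncard

/-- The number of arcs with head `v`. -/
noncomputable def EdgeOrientation.inDeg {G : Graph α β} (D : G.EdgeOrientation) (v : α) : ℕ :=
  {e : E(G) | D.head e = v}.ncard

/-- `b : V(G) → {0, …, 2ℓ - 1}` is a (parity-compliant) `ℤ_{2ℓ}`-boundary of the finite
graph `G`. -/
def IsBoundary (G : Graph α β) (ℓ : ℕ) (b : V(G) → Fin (2 * ℓ)) : Prop :=
  (∀ v : V(G), (b v : ℕ) ≡ G.deg v [MOD 2]) ∧ (∑ᶠ v : V(G), (b v : ℕ)) ≡ 0 [MOD 2 * ℓ]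

/-- `D` is a `b`-orientation of `G`. -/
def EdgeOrientation.Realizes {G : Graph α β} {ℓ : ℕ} (D : G.EdgeOrientation)
    (b : V(G) → Fin (2 * ℓ)) : Prop :=
  ∀ v : V(G), (D.outDeg v : ℤ) - (D.inDeg v : ℤ) ≡ ((b v : ℕ) : ℤ) [ZMOD 2 * (ℓ : ℤ)]

/-- `G` is strongly `ℤ_ℓ`-connected. -/
def StronglyConnectedMod (G : Graph α β) (ℓ : ℕ) : Prop :=
  ∀ b : V(G) → Fin (2 * ℓ), G.IsBoundary ℓ b → ∃ D : G.EdgeOrientation, D.Realizes b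

end Graph

/-! An orientation realizes `β` exactly when every out-degree satisfies `2 o(v) - d(v) ≡ β(v)`
modulo `2ℓ`, that is, `o(v) ≡ p(v) = (β(v) + d(v)) / 2` modulo `ℓ`. By Hakimi's theorem the question
becomes one about integers: raise residues by multiples of `ℓ` to reach total `3ℓ - 3`, so that
every vertex set `S` spans at most `o(S)` edges.

Residues in `[0, ℓ)` sum to `3ℓ - 3`, `2ℓ - 3` or `ℓ - 3`. Call `ij` bad if `p i + p j < m i j`.
Since `e(G) - m k l ≥ 2ℓ - 1` for the opposite pair `kl`, a bad pair `ij` satisfies `d i + d j ≥ p i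
+ p j + 2ℓ`, so one of its ends has room for `ℓ` more. This settles all cases except the one where
the sum is `ℓ - 3` and all six pairs are bad. Counting edges then forces `m i j = p i + p j + 1`:
opposite multiplicities sum to `ℓ - 1` and `β = ℓ` everywhere.

Conversely, in that configuration `β = ℓ` forces `2 o - d = ±ℓ`, and the two vertices with `-ℓ` have
too few outgoing arcs for the edges between them. -/

/-- Out-degrees on four vertices with pairwise multiplicities `m₁₂, …, m₃₄` that satisfy Hakimi's
condition and the prescribed residues `p₁, …, p₄` modulo `l`. -/
def IsOutDegrees (l m₁₂ m₁₃ m₁₄ m₂₃ m₂₄ m₃₄ p₁ p₂ p₃ p₄ o₁ o₂ o₃ o₄ : ℤ) : Prop :=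
  (o₁ + o₂ + o₃ + o₄ = m₁₂ + m₁₃ + m₁₄ + m₂₃ + m₂₄ + m₃₄) ∧
  (0 ≤ o₁ ∧ 0 ≤ o₂ ∧ 0 ≤ o₃ ∧ 0 ≤ o₄) ∧
  (m₁₂ ≤ o₁ + o₂ ∧ m₁₃ ≤ o₁ + o₃ ∧ m₁₄ ≤ o₁ + o₄ ∧
    m₂₃ ≤ o₂ + o₃ ∧ m₂₄ ≤ o₂ + o₄ ∧ m₃₄ ≤ o₃ + o₄) ∧
  (o₁ ≤ m₁₂ + m₁₃ + m₁₄ ∧ o₂ ≤ m₁₂ + m₂₃ + m₂₄ ∧ o₃ ≤ m₁₃ + m₂₃ + m₃₄ ∧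
    o₄ ≤ m₁₄ + m₂₄ + m₃₄) ∧
  (o₁ ≡ p₁ [ZMOD l] ∧ o₂ ≡ p₂ [ZMOD l] ∧ o₃ ≡ p₃ [ZMOD l] ∧ o₄ ≡ p₄ [ZMOD l])

/-! ### Choosing out-degrees in prescribed residue classes -/

section OutDegrees

variable {l m₁₂ m₁₃ m₁₄ m₂₃ m₂₄ m₃₄ p₁ p₂ p₃ p₄ : ℤ}

theorem IsOutDegrees.of_add_mul {c₁ c₂ c₃ c₄ : ℤ}
    (hs : (p₁ + l * c₁) + (p₂ + l * c₂) + (p₃ + l * c₃) + (p₄ + l * c₄)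
      = m₁₂ + m₁₃ + m₁₄ + m₂₃ + m₂₄ + m₃₄)
    (h0 : 0 ≤ p₁ + l * c₁ ∧ 0 ≤ p₂ + l * c₂ ∧ 0 ≤ p₃ + l * c₃ ∧ 0 ≤ p₄ + l * c₄)
    (h2 : m₁₂ ≤ (p₁ + l * c₁) + (p₂ + l * c₂) ∧ m₁₃ ≤ (p₁ + l * c₁) + (p₃ + l * c₃) ∧
      m₁₄ ≤ (p₁ + l * c₁) + (p₄ + l * c₄) ∧ m₂₃ ≤ (p₂ + l * c₂) + (p₃ + l * c₃) ∧
      m₂₄ ≤ (p₂ + l * c₂) + (p₄ + l * c₄) ∧ m₃₄ ≤ (p₃ + l * c₃) + (p₄ + l * c₄))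
    (h3 : p₁ + l * c₁ ≤ m₁₂ + m₁₃ + m₁₄ ∧ p₂ + l * c₂ ≤ m₁₂ + m₂₃ + m₂₄ ∧
      p₃ + l * c₃ ≤ m₁₃ + m₂₃ + m₃₄ ∧ p₄ + l * c₄ ≤ m₁₄ + m₂₄ + m₃₄) :
    ∃ o₁ o₂ o₃ o₄,
      IsOutDegrees l m₁₂ m₁₃ m₁₄ m₂₃ m₂₄ m₃₄ p₁ p₂ p₃ p₄ o₁ o₂ o₃ o₄ :=
  ⟨p₁ + l * c₁, p₂ + l * c₂, p₃ + l * c₃, p₄ + l * c₄, hs, h0, h2, h3,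
    by simp [Int.ModEq], by simp [Int.ModEq], by simp [Int.ModEq], by simp [Int.ModEq]⟩

/-- One residue must be raised by `l`. Pairs through the raised vertex `i` then have sum at least
`l`, so only `p i + l ≤ d i` and the three pairs avoiding `i` need checking. -/
theorem exists_isOutDegrees_of_sum_eq_two_mul_sub_three
    (hm : (0 ≤ m₁₂ ∧ 0 ≤ m₁₃ ∧ 0 ≤ m₁₄ ∧ 0 ≤ m₂₃ ∧ 0 ≤ m₂₄ ∧ 0 ≤ m₃₄))
    (hμ : m₁₂ ≤ l - 2 ∧ m₁₃ ≤ l - 2 ∧ m₁₄ ≤ l - 2 ∧ m₂₃ ≤ l - 2 ∧ m₂₄ ≤ l - 2 ∧ m₃₄ ≤ l - 2)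
    (hE : m₁₂ + m₁₃ + m₁₄ + m₂₃ + m₂₄ + m₃₄ = 3 * l - 3)
    (hδ : l - 1 ≤ m₁₂ + m₁₃ + m₁₄ ∧ l - 1 ≤ m₁₂ + m₂₃ + m₂₄ ∧ l - 1 ≤ m₁₃ + m₂₃ + m₃₄ ∧
      l - 1 ≤ m₁₄ + m₂₄ + m₃₄)
    (hp : (0 ≤ p₁ ∧ 0 ≤ p₂ ∧ 0 ≤ p₃ ∧ 0 ≤ p₄) ∧ (p₁ < l ∧ p₂ < l ∧ p₃ < l ∧ p₄ < l))
    (hs : p₁ + p₂ + p₃ + p₄ = 2 * l - 3) :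
    ∃ o₁ o₂ o₃ o₄, IsOutDegrees l m₁₂ m₁₃ m₁₄ m₂₃ m₂₄ m₃₄ p₁ p₂ p₃ p₄ o₁ o₂ o₃ o₄ := by
  by_cases h1 : p₁ + l ≤ m₁₂ + m₁₃ + m₁₄ ∧ m₂₃ ≤ p₂ + p₃ ∧ m₂₄ ≤ p₂ + p₄ ∧ m₃₄ ≤ p₃ + p₄
  · apply IsOutDegrees.of_add_mul (c₁ := 1) (c₂ := 0) (c₃ := 0) (c₄ := 0) <;> omega
  by_cases h2 : p₂ + l ≤ m₁₂ + m₂₃ + m₂₄ ∧ m₁₃ ≤ p₁ + p₃ ∧ m₁₄ ≤ p₁ + p₄ ∧ m₃₄ ≤ p₃ + p₄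
  · apply IsOutDegrees.of_add_mul (c₁ := 0) (c₂ := 1) (c₃ := 0) (c₄ := 0) <;> omega
  by_cases h3 : p₃ + l ≤ m₁₃ + m₂₃ + m₃₄ ∧ m₁₂ ≤ p₁ + p₂ ∧ m₁₄ ≤ p₁ + p₄ ∧ m₂₄ ≤ p₂ + p₄
  · apply IsOutDegrees.of_add_mul (c₁ := 0) (c₂ := 0) (c₃ := 1) (c₄ := 0) <;> omega
  by_cases h4 : p₄ + l ≤ m₁₄ + m₂₄ + m₃₄ ∧ m₁₂ ≤ p₁ + p₂ ∧ m₁₃ ≤ p₁ + p₃ ∧ m₂₃ ≤ p₂ + p₃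
  · apply IsOutDegrees.of_add_mul (c₁ := 0) (c₂ := 0) (c₃ := 0) (c₄ := 1) <;> omega
  -- Two opposite pairs are never both bad: the total would be at most `2 l - 6`. With no bad pair,
  -- summing `p i + l > d i` contradicts the degree sum `6 l - 6`. A single bad pair has an end with
  -- room. Two bad pairs at `i` give `d i ≥ p i + l`. A bad triangle leaves the fourth vertex with
  -- degree at most `l - 2`.
  exfalso
  by_cases b12 : m₁₂ ≤ p₁ + p₂ <;> by_cases b13 : m₁₃ ≤ p₁ + p₃ <;>
    by_cases b14 : m₁₄ ≤ p₁ + p₄ <;> by_cases b23 : m₂₃ ≤ p₂ + p₃ <;>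
    by_cases b24 : m₂₄ ≤ p₂ + p₄ <;> by_cases b34 : m₃₄ ≤ p₃ + p₄ <;>
    simp only [b12, b13, b14, b23, b24, b34, and_true, and_false, not_false_eq_true]
      at h1 h2 h3 h4 <;> omega

-- The missing `2 l` goes to one vertex or is split between two. Splitting it between `i` and `j`
-- requires room at both and that the opposite pair is not bad.
set_option maxHeartbeats 1000000 in
theorem exists_isOutDegrees_or_of_sum_eq_sub_three (hl : 3 ≤ l)
    (hm : (0 ≤ m₁₂ ∧ 0 ≤ m₁₃ ∧ 0 ≤ m₁₄ ∧ 0 ≤ m₂₃ ∧ 0 ≤ m₂₄ ∧ 0 ≤ m₃₄))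
    (hμ : m₁₂ ≤ l - 2 ∧ m₁₃ ≤ l - 2 ∧ m₁₄ ≤ l - 2 ∧ m₂₃ ≤ l - 2 ∧ m₂₄ ≤ l - 2 ∧ m₃₄ ≤ l - 2)
    (hE : m₁₂ + m₁₃ + m₁₄ + m₂₃ + m₂₄ + m₃₄ = 3 * l - 3)
    (hδ : l - 1 ≤ m₁₂ + m₁₃ + m₁₄ ∧ l - 1 ≤ m₁₂ + m₂₃ + m₂₄ ∧ l - 1 ≤ m₁₃ + m₂₃ + m₃₄ ∧
      l - 1 ≤ m₁₄ + m₂₄ + m₃₄)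
    (hp : (0 ≤ p₁ ∧ 0 ≤ p₂ ∧ 0 ≤ p₃ ∧ 0 ≤ p₄) ∧ (p₁ < l ∧ p₂ < l ∧ p₃ < l ∧ p₄ < l))
    (hs : p₁ + p₂ + p₃ + p₄ = l - 3) :
    (∃ o₁ o₂ o₃ o₄, IsOutDegrees l m₁₂ m₁₃ m₁₄ m₂₃ m₂₄ m₃₄ p₁ p₂ p₃ p₄ o₁ o₂ o₃ o₄) ∨
      (m₁₂ + m₃₄ = l - 1 ∧ m₁₃ + m₂₄ = l - 1 ∧ m₁₄ + m₂₃ = l - 1 ∧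
        2 * p₁ = m₁₂ + m₁₃ + m₁₄ - l ∧ 2 * p₂ = m₁₂ + m₂₃ + m₂₄ - l ∧
        2 * p₃ = m₁₃ + m₂₃ + m₃₄ - l ∧ 2 * p₄ = m₁₄ + m₂₄ + m₃₄ - l) := by
  by_cases h1 : p₁ + 2 * l ≤ m₁₂ + m₁₃ + m₁₄ ∧ m₂₃ ≤ p₂ + p₃ ∧ m₂₄ ≤ p₂ + p₄ ∧ m₃₄ ≤ p₃ + p₄
  · left
    apply IsOutDegrees.of_add_mul (c₁ := 2) (c₂ := 0) (c₃ := 0) (c₄ := 0) <;> omega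
  by_cases h2 : p₂ + 2 * l ≤ m₁₂ + m₂₃ + m₂₄ ∧ m₁₃ ≤ p₁ + p₃ ∧ m₁₄ ≤ p₁ + p₄ ∧ m₃₄ ≤ p₃ + p₄
  · left
    apply IsOutDegrees.of_add_mul (c₁ := 0) (c₂ := 2) (c₃ := 0) (c₄ := 0) <;> omega
  by_cases h3 : p₃ + 2 * l ≤ m₁₃ + m₂₃ + m₃₄ ∧ m₁₂ ≤ p₁ + p₂ ∧ m₁₄ ≤ p₁ + p₄ ∧ m₂₄ ≤ p₂ + p₄
  · left
    apply IsOutDegrees.of_add_mul (c₁ := 0) (c₂ := 0) (c₃ := 2) (c₄ := 0) <;> omega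
  by_cases h4 : p₄ + 2 * l ≤ m₁₄ + m₂₄ + m₃₄ ∧ m₁₂ ≤ p₁ + p₂ ∧ m₁₃ ≤ p₁ + p₃ ∧ m₂₃ ≤ p₂ + p₃
  · left
    apply IsOutDegrees.of_add_mul (c₁ := 0) (c₂ := 0) (c₃ := 0) (c₄ := 2) <;> omega
  by_cases h12 : p₁ + l ≤ m₁₂ + m₁₃ + m₁₄ ∧ p₂ + l ≤ m₁₂ + m₂₃ + m₂₄ ∧ m₃₄ ≤ p₃ + p₄
  · left
    apply IsOutDegrees.of_add_mul (c₁ := 1) (c₂ := 1) (c₃ := 0) (c₄ := 0) <;> omega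
  by_cases h13 : p₁ + l ≤ m₁₂ + m₁₃ + m₁₄ ∧ p₃ + l ≤ m₁₃ + m₂₃ + m₃₄ ∧ m₂₄ ≤ p₂ + p₄
  · left
    apply IsOutDegrees.of_add_mul (c₁ := 1) (c₂ := 0) (c₃ := 1) (c₄ := 0) <;> omega
  by_cases h14 : p₁ + l ≤ m₁₂ + m₁₃ + m₁₄ ∧ p₄ + l ≤ m₁₄ + m₂₄ + m₃₄ ∧ m₂₃ ≤ p₂ + p₃
  · left
    apply IsOutDegrees.of_add_mul (c₁ := 1) (c₂ := 0) (c₃ := 0) (c₄ := 1) <;> omega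
  by_cases h23 : p₂ + l ≤ m₁₂ + m₂₃ + m₂₄ ∧ p₃ + l ≤ m₁₃ + m₂₃ + m₃₄ ∧ m₁₄ ≤ p₁ + p₄
  · left
    apply IsOutDegrees.of_add_mul (c₁ := 0) (c₂ := 1) (c₃ := 1) (c₄ := 0) <;> omega
  by_cases h24 : p₂ + l ≤ m₁₂ + m₂₃ + m₂₄ ∧ p₄ + l ≤ m₁₄ + m₂₄ + m₃₄ ∧ m₁₃ ≤ p₁ + p₃
  · left
    apply IsOutDegrees.of_add_mul (c₁ := 0) (c₂ := 1) (c₃ := 0) (c₄ := 1) <;> omega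
  by_cases h34 : p₃ + l ≤ m₁₃ + m₂₃ + m₃₄ ∧ p₄ + l ≤ m₁₄ + m₂₄ + m₃₄ ∧ m₁₂ ≤ p₁ + p₂
  · left
    apply IsOutDegrees.of_add_mul (c₁ := 0) (c₂ := 0) (c₃ := 1) (c₄ := 1) <;> omega
  -- If all four vertices have room for `l`, all six pairs are bad and the edge count makes each
  -- excess exactly 1. If only `i` lacks room, the three pairs at `i` are bad, whence `d i ≥ 2 p i +
  -- l`, a contradiction. Two vertices without room do not form a bad pair, so with exactly two the
  -- others can be raised; with three the fourth takes `2 l`; four contradict the degree sum.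
  right
  by_cases g1 : p₁ + l ≤ m₁₂ + m₁₃ + m₁₄ <;> by_cases g2 : p₂ + l ≤ m₁₂ + m₂₃ + m₂₄ <;>
    by_cases g3 : p₃ + l ≤ m₁₃ + m₂₃ + m₃₄ <;> by_cases g4 : p₄ + l ≤ m₁₄ + m₂₄ + m₃₄ <;>
    simp only [g1, g2, g3, g4, true_and, false_and, not_false_eq_true]
      at h12 h13 h14 h23 h24 h34 <;> omega

theorem exists_isOutDegrees_or (hl : 3 ≤ l)
    (hm : (0 ≤ m₁₂ ∧ 0 ≤ m₁₃ ∧ 0 ≤ m₁₄ ∧ 0 ≤ m₂₃ ∧ 0 ≤ m₂₄ ∧ 0 ≤ m₃₄))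
    (hμ : m₁₂ ≤ l - 2 ∧ m₁₃ ≤ l - 2 ∧ m₁₄ ≤ l - 2 ∧ m₂₃ ≤ l - 2 ∧ m₂₄ ≤ l - 2 ∧ m₃₄ ≤ l - 2)
    (hE : m₁₂ + m₁₃ + m₁₄ + m₂₃ + m₂₄ + m₃₄ = 3 * l - 3)
    (hδ : l - 1 ≤ m₁₂ + m₁₃ + m₁₄ ∧ l - 1 ≤ m₁₂ + m₂₃ + m₂₄ ∧ l - 1 ≤ m₁₃ + m₂₃ + m₃₄ ∧
      l - 1 ≤ m₁₄ + m₂₄ + m₃₄)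
    (hs : l ∣ p₁ + p₂ + p₃ + p₄ + 3) :
    (∃ o₁ o₂ o₃ o₄, IsOutDegrees l m₁₂ m₁₃ m₁₄ m₂₃ m₂₄ m₃₄ p₁ p₂ p₃ p₄ o₁ o₂ o₃ o₄) ∨
      (m₁₂ + m₃₄ = l - 1 ∧ m₁₃ + m₂₄ = l - 1 ∧ m₁₄ + m₂₃ = l - 1 ∧
        2 * p₁ ≡ m₁₂ + m₁₃ + m₁₄ - l [ZMOD 2 * l] ∧
        2 * p₂ ≡ m₁₂ + m₂₃ + m₂₄ - l [ZMOD 2 * l] ∧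
        2 * p₃ ≡ m₁₃ + m₂₃ + m₃₄ - l [ZMOD 2 * l] ∧
        2 * p₄ ≡ m₁₄ + m₂₄ + m₃₄ - l [ZMOD 2 * l]) := by
  have hl0 : 0 < l := by omega
  have e (p : ℤ) : p % l ≡ p [ZMOD l] := Int.mod_modEq p l
  have hp : (0 ≤ p₁ % l ∧ 0 ≤ p₂ % l ∧ 0 ≤ p₃ % l ∧ 0 ≤ p₄ % l) ∧
      (p₁ % l < l ∧ p₂ % l < l ∧ p₃ % l < l ∧ p₄ % l < l) := by
    have a (p : ℤ) : 0 ≤ p % l := Int.emod_nonneg p hl0.ne'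
    have b (p : ℤ) : p % l < l := Int.emod_lt_of_pos p hl0
    exact ⟨⟨a _, a _, a _, a _⟩, b _, b _, b _, b _⟩
  have lift (h : ∃ o₁ o₂ o₃ o₄, IsOutDegrees l m₁₂ m₁₃ m₁₄ m₂₃ m₂₄ m₃₄
      (p₁ % l) (p₂ % l) (p₃ % l) (p₄ % l) o₁ o₂ o₃ o₄) :
      ∃ o₁ o₂ o₃ o₄, IsOutDegrees l m₁₂ m₁₃ m₁₄ m₂₃ m₂₄ m₃₄ p₁ p₂ p₃ p₄ o₁ o₂ o₃ o₄ := by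
    obtain ⟨o₁, o₂, o₃, o₄, a, b, c, d, r₁, r₂, r₃, r₄⟩ := h
    exact ⟨o₁, o₂, o₃, o₄, a, b, c, d,
      r₁.trans (e _), r₂.trans (e _), r₃.trans (e _), r₄.trans (e _)⟩
  obtain ⟨k, hk⟩ : l ∣ p₁ % l + p₂ % l + p₃ % l + p₄ % l + 3 := by
    rw [← Int.modEq_zero_iff_dvd] at hs ⊢
    exact (((((e p₁).add (e p₂)).add (e p₃)).add (e p₄)).add_right 3).trans hs
  -- The residue sum lies between `0` and `4 l - 4`, so `l * k` lies between `3` and `4 l - 1`.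
  have hk0 : 0 < k := by
    by_contra! h
    have := mul_nonpos_of_nonneg_of_nonpos hl0.le h
    omega
  have hk4 : k < 4 := by
    by_contra! h
    have := mul_le_mul_of_nonneg_left h hl0.le
    omega
  obtain rfl | rfl | rfl : k = 1 ∨ k = 2 ∨ k = 3 := by omega
  · refine (exists_isOutDegrees_or_of_sum_eq_sub_three hl hm hμ hE hδ hp (by omega)).imp lift ?_
    rintro ⟨a, b, c, h₁, h₂, h₃, h₄⟩
    refine ⟨a, b, c, ?_, ?_, ?_, ?_⟩
    · exact h₁ ▸ ((e p₁).mul_left' (c := 2)).symm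
    · exact h₂ ▸ ((e p₂).mul_left' (c := 2)).symm
    · exact h₃ ▸ ((e p₃).mul_left' (c := 2)).symm
    · exact h₄ ▸ ((e p₄).mul_left' (c := 2)).symm
  · exact .inl (lift (exists_isOutDegrees_of_sum_eq_two_mul_sub_three hm hμ hE hδ hp
      (by omega)))
  · left
    apply lift
    apply IsOutDegrees.of_add_mul (c₁ := 0) (c₂ := 0) (c₃ := 0) (c₄ := 0) <;> omega

/-- In the exceptional configuration no out-degrees satisfy `2 o - d ≡ l` modulo `2 l`. -/
theorem not_outDegrees_of_opposite_sum {o₁ o₂ o₃ o₄ : ℤ} (hl : 3 ≤ l)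
    (hμ : m₁₂ ≤ l - 2 ∧ m₁₃ ≤ l - 2 ∧ m₁₄ ≤ l - 2 ∧ m₂₃ ≤ l - 2 ∧ m₂₄ ≤ l - 2 ∧ m₃₄ ≤ l - 2)
    (hopp : m₁₂ + m₃₄ = l - 1 ∧ m₁₃ + m₂₄ = l - 1 ∧ m₁₄ + m₂₃ = l - 1)
    (hsum : o₁ + o₂ + o₃ + o₄ = m₁₂ + m₁₃ + m₁₄ + m₂₃ + m₂₄ + m₃₄)
    (h0 : 0 ≤ o₁ ∧ 0 ≤ o₂ ∧ 0 ≤ o₃ ∧ 0 ≤ o₄)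
    (h2 : m₁₂ ≤ o₁ + o₂ ∧ m₁₃ ≤ o₁ + o₃ ∧ m₁₄ ≤ o₁ + o₄ ∧
      m₂₃ ≤ o₂ + o₃ ∧ m₂₄ ≤ o₂ + o₄ ∧ m₃₄ ≤ o₃ + o₄)
    (h3 : o₁ ≤ m₁₂ + m₁₃ + m₁₄ ∧ o₂ ≤ m₁₂ + m₂₃ + m₂₄ ∧ o₃ ≤ m₁₃ + m₂₃ + m₃₄ ∧
      o₄ ≤ m₁₄ + m₂₄ + m₃₄)
    (r₁ : 2 * o₁ - (m₁₂ + m₁₃ + m₁₄) ≡ l [ZMOD 2 * l])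
    (r₂ : 2 * o₂ - (m₁₂ + m₂₃ + m₂₄) ≡ l [ZMOD 2 * l])
    (r₃ : 2 * o₃ - (m₁₃ + m₂₃ + m₃₄) ≡ l [ZMOD 2 * l])
    (r₄ : 2 * o₄ - (m₁₄ + m₂₄ + m₃₄) ≡ l [ZMOD 2 * l]) : False := by
  -- Here `|2 o - d| ≤ d ≤ 3 (l - 2)`, which leaves only the values `l` and `-l`.
  have key {x : ℤ} (hx : x ≡ l [ZMOD 2 * l]) (h1 : -(3 * l) < x) (h2 : x < 3 * l) :
      x = l ∨ x = -l := by
    obtain ⟨k, hk⟩ := hx.symm.dvd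
    have : -2 < k := by
      by_contra! h
      have := mul_le_mul_of_nonneg_left h (show 0 ≤ l by omega)
      grind
    have : k < 1 := by
      by_contra! h
      have := mul_le_mul_of_nonneg_left h (show 0 ≤ l by omega)
      grind
    obtain rfl | rfl : k = -1 ∨ k = 0 := by omega
    all_goals omega
  -- The four values sum to zero, so exactly two equal `-l`, say at `i` and `j`. As `d i + d j = 2 m
  -- i j + 2 l - 2`, this gives `o i + o j = m i j - 1`.
  rcases key r₁ (by omega) (by omega) with h | h <;>
  rcases key r₂ (by omega) (by omega) with h' | h' <;>
  rcases key r₃ (by omega) (by omega) with h'' | h'' <;>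
  rcases key r₄ (by omega) (by omega) with h''' | h''' <;> omega

end OutDegrees

/-! ### Hakimi's theorem and degrees of orientations -/

namespace Graph

variable {α β : Type*} {G : Graph α β}

/-- Hakimi's theorem: a finite graph has an orientation with prescribed out-degrees `o` provided
that they sum to the number of edges and that every vertex set `S` spans at most `∑ v ∈ S, o v`
edges. -/
theorem exists_edgeOrientation_outDeg_eq (V : Finset α) (hV : V(G) = V) (hE : E(G).Finite)
    (o : α → ℕ) (hsum : ∑ v ∈ V, o v = E(G).ncard)
    (ho : ∀ S ⊆ V, {e | ∃ x ∈ S, ∃ y ∈ S, G.IsLink e x y}.ncard ≤ ∑ v ∈ S, o v) :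
    ∃ D : G.EdgeOrientation, ∀ v ∈ V, D.outDeg v = o v := by
  classical
  have : Finite E(G) := hE
  have := Fintype.ofFinite E(G)
  -- Each vertex `v` offers `o v` slots; an injective assignment of edges to slots at their ends
  -- chooses the tails.
  let slot (v : α) : Finset (α × ℕ) := {v} ×ˢ Finset.range (o v)
  have mem_slot {v : α} {q : α × ℕ} : q ∈ slot v ↔ q.1 = v ∧ q.2 < o v := by
    simp only [slot, Finset.mem_product, Finset.mem_singleton, Finset.mem_range]
  have card_slots (S : Finset α) : (S.biUnion slot).card = ∑ v ∈ S, o v := by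
    rw [Finset.card_biUnion]
    · simp [slot]
    · intro a _ b _ hab
      exact Finset.disjoint_left.2 fun q hq hq' ↦ hab ((mem_slot.1 hq).1.symm.trans (mem_slot.1 hq').1)
  let t (e : E(G)) : Finset (α × ℕ) := {v ∈ V | G.Inc e v}.biUnion slot
  -- Hall's condition: the edges of `A` see all slots at the set `S` of their ends, and `S` spans
  -- `A`.
  have hall (A : Finset E(G)) : A.card ≤ (A.biUnion t).card := by
    set S : Finset α := {v ∈ V | ∃ e ∈ A, G.Inc e v} with hS
    have h1 : A.biUnion t = S.biUnion slot := by
      ext q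
      simp only [t, hS, Finset.mem_biUnion, Finset.mem_filter]
      constructor
      · rintro ⟨e, he, v, ⟨hv, hi⟩, hq⟩
        exact ⟨v, ⟨hv, e, he, hi⟩, hq⟩
      · rintro ⟨v, ⟨hv, e, he, hi⟩, hq⟩
        exact ⟨e, he, v, ⟨hv, hi⟩, hq⟩
    rw [h1, card_slots]
    refine le_trans ?_ (ho S (Finset.filter_subset _ _))
    rw [← Set.ncard_coe_finset, ← Set.ncard_image_of_injective (A : Set E(G)) Subtype.val_injective]
    refine Set.ncard_le_ncard ?_ (hE.subset ?_)
    · rintro _ ⟨e, he, rfl⟩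
      obtain ⟨x, y, h⟩ := G.exists_isLink_of_mem_edgeSet e.2
      have hx : x ∈ V := by simpa [hV] using h.left_mem
      have hy : y ∈ V := by simpa [hV] using h.right_mem
      exact ⟨x, Finset.mem_filter.2 ⟨hx, e, he, h.inc_left⟩,
        y, Finset.mem_filter.2 ⟨hy, e, he, h.inc_right⟩, h⟩
    · rintro e ⟨x, _, y, _, h⟩
      exact h.edge_mem
  obtain ⟨f, hf, hft⟩ :=
    (Finset.all_card_le_biUnion_card_iff_exists_injective t).1 hall
  have hf' (e : E(G)) : G.Inc e (f e).1 ∧ f e ∈ V.biUnion slot := by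
    have := hft e
    simp only [t, Finset.mem_biUnion, Finset.mem_filter] at this ⊢
    obtain ⟨v, ⟨hv, hi⟩, hq⟩ := this
    exact ⟨(mem_slot.1 hq).1 ▸ hi, v, hv, hq⟩
  -- There are as many slots as edges, so every slot is used and the out-degrees are exact.
  have himg : Finset.univ.image f = V.biUnion slot := by
    apply Finset.eq_of_subset_of_card_le
    · intro q hq
      obtain ⟨e, _, rfl⟩ := Finset.mem_image.1 hq
      exact (hf' e).2
    · rw [card_slots, hsum, Finset.card_image_of_injective _ hf, Finset.card_univ,
        ← Nat.card_eq_fintype_card, Nat.card_coe_set_eq]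
  refine ⟨⟨fun e ↦ (f e).1, fun e ↦ (hf' e).1.other, fun e ↦ (hf' e).1.isLink_other⟩, ?_⟩
  intro v hv
  have : f '' {e | (f e).1 = v} = (slot v : Set (α × ℕ)) := by
    ext q
    constructor
    · rintro ⟨e, he, rfl⟩
      obtain ⟨w, _, hw⟩ := Finset.mem_biUnion.1 (hf' e).2
      have : v = w := he.symm.trans (mem_slot.1 hw).1
      exact this ▸ hw
    · intro hq
      have hq' : q ∈ Finset.univ.image f := himg ▸ Finset.mem_biUnion.2 ⟨v, hv, hq⟩
      obtain ⟨e, _, rfl⟩ := Finset.mem_image.1 hq'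
      exact ⟨e, (mem_slot.1 hq).1, rfl⟩
  change {e : E(G) | (f e).1 = v}.ncard = o v
  rw [← Set.ncard_image_of_injective _ hf, this, Set.ncard_coe_finset]
  simp [slot]

theorem deg_eq_ncard_incidenceSet [G.Loopless] (v : α) : G.deg v = (G.incidenceSet v).ncard := by
  have : G.loopSet v = ∅ := by
    ext e
    simp
  simp [deg, this]

theorem EdgeOrientation.outDeg_add_inDeg [G.Loopless] (hE : E(G).Finite) (D : G.EdgeOrientation)
    (v : α) : D.outDeg v + D.inDeg v = G.deg v := by
  have : Finite E(G) := hE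
  rw [deg_eq_ncard_incidenceSet, outDeg, inDeg, ← Set.ncard_union_eq,
    ← Set.ncard_image_of_injective _ Subtype.val_injective]
  · congr 1
    ext e
    constructor
    · rintro ⟨e, rfl | rfl, rfl⟩
      · exact (D.isLink e).inc_left
      · exact (D.isLink e).inc_right
    · intro he
      refine ⟨⟨e, Inc.edge_mem he⟩, ?_, rfl⟩
      exact (Inc.eq_or_eq_of_isLink he (D.isLink ⟨e, Inc.edge_mem he⟩)).imp Eq.symm Eq.symm
  · rw [Set.disjoint_left]
    intro e h h'
    exact (D.isLink e).ne (h.trans h'.symm)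

theorem EdgeOrientation.sum_outDeg (V : Finset α) (hV : V(G) = V) (hE : E(G).Finite)
    (D : G.EdgeOrientation) : ∑ v ∈ V, D.outDeg v = E(G).ncard := by
  classical
  have : Finite E(G) := hE
  have := Fintype.ofFinite E(G)
  have h := Finset.card_eq_sum_card_fiberwise (s := Finset.univ) (t := V) (f := D.tail)
    (fun e _ ↦ by simpa [hV] using (D.isLink e).left_mem)
  rw [← Nat.card_coe_set_eq, Nat.card_eq_fintype_card, ← Finset.card_univ, h]
  refine Finset.sum_congr rfl fun v _ ↦ ?_
  rw [outDeg, ← Set.ncard_coe_finset]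
  simp

theorem EdgeOrientation.edgeMult_le_outDeg_add_outDeg (hE : E(G).Finite) (D : G.EdgeOrientation)
    (x y : α) : G.edgeMult x y ≤ D.outDeg x + D.outDeg y := by
  have : Finite E(G) := hE
  refine le_trans ?_ (Set.ncard_union_le _ _)
  rw [edgeMult, ← Set.ncard_image_of_injective (_ ∪ _) Subtype.val_injective]
  refine Set.ncard_le_ncard ?_ (Set.toFinite _)
  intro e he
  have he' : G.IsLink e x y := he
  exact ⟨⟨e, he'.edge_mem⟩, (D.isLink ⟨e, he'.edge_mem⟩).left_eq_or_eq he', rfl⟩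

theorem edgeMult_le_maxMult (hE : E(G).Finite) {x y : α} (hx : x ∈ V(G)) (hy : y ∈ V(G))
    (hxy : x ≠ y) : G.edgeMult x y ≤ G.maxMult := by
  -- An unbounded `sSup` in `ℕ` is `0`, so the bound by the number of edges is needed.
  refine le_csSup ⟨E(G).ncard, ?_⟩ ⟨x, hx, y, hy, hxy, rfl⟩
  rintro _ ⟨x, _, y, _, _, rfl⟩
  exact Set.ncard_le_ncard (fun e he ↦ IsLink.edge_mem he) hE

theorem minDeg_le_deg {v : α} (hv : v ∈ V(G)) : G.minDeg ≤ G.deg v :=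
  Nat.sInf_le ⟨v, hv, rfl⟩

end Graph

/-! ### Counting edges on four vertices -/

namespace Graph

variable {α β : Type*} {G : Graph α β} {v₁ v₂ v₃ v₄ : α}

open Classical in
-- Suitable choices of `Q` yield the edge number, degrees, cuts and spanned edges.
theorem ncard_setOf_isLink_of_vertexSet_eq [G.Loopless] (hE : E(G).Finite)
    (hV : V(G) = {v₁, v₂, v₃, v₄}) (h₁₂ : v₁ ≠ v₂) (h₁₃ : v₁ ≠ v₃) (h₁₄ : v₁ ≠ v₄)
    (h₂₃ : v₂ ≠ v₃) (h₂₄ : v₂ ≠ v₄) (h₃₄ : v₃ ≠ v₄) {Q : α → α → Prop}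
    (hQ : ∀ x y, Q x y ↔ Q y x) :
    {e | ∃ x y, Q x y ∧ G.IsLink e x y}.ncard =
      (if Q v₁ v₂ then G.edgeMult v₁ v₂ else 0) + (if Q v₁ v₃ then G.edgeMult v₁ v₃ else 0) +
      (if Q v₁ v₄ then G.edgeMult v₁ v₄ else 0) + (if Q v₂ v₃ then G.edgeMult v₂ v₃ else 0) +
      (if Q v₂ v₄ then G.edgeMult v₂ v₄ else 0) + (if Q v₃ v₄ then G.edgeMult v₃ v₄ else 0) := by
  have count {p : β → Prop} (hp : ∀ e, p e → e ∈ E(G)) :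
      {e | p e}.ncard = ∑ e ∈ hE.toFinset, if p e then 1 else 0 := by
    rw [← Finset.card_filter, ← Set.ncard_coe_finset]
    congr 1
    ext e
    simpa using hp e
  have mult (x y : α) : G.edgeMult x y = ∑ e ∈ hE.toFinset, if G.IsLink e x y then 1 else 0 :=
    count fun e he ↦ he.edge_mem
  have mult' (x y : α) : (if Q x y then G.edgeMult x y else 0) =
      ∑ e ∈ hE.toFinset, if Q x y ∧ G.IsLink e x y then 1 else 0 := by
    split_ifs with h <;> simp [h, mult]
  rw [count (by rintro e ⟨x, y, -, h⟩; exact h.edge_mem)]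
  simp only [mult', ← Finset.sum_add_distrib]
  refine Finset.sum_congr rfl fun e he ↦ ?_
  obtain ⟨x, y, h⟩ := G.exists_isLink_of_mem_edgeSet (hE.mem_toFinset.1 he)
  have hx := h.left_mem
  have hy := h.right_mem
  have hxy := h.ne
  have hex : (∃ x' y', Q x' y' ∧ G.IsLink e x' y') ↔ Q x y := by
    constructor
    · rintro ⟨x', y', hq, h'⟩
      obtain ⟨rfl, rfl⟩ | ⟨rfl, rfl⟩ := h.eq_and_eq_or_eq_and_eq h'
      · exact hq
      · exact (hQ _ _).1 hq
    · exact fun hq ↦ ⟨x, y, hq, h⟩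
  simp only [hex]
  simp only [h.isLink_iff]
  have hq := hQ x y
  rw [hV] at hx hy
  clear hex hQ count mult mult' h he hV hE
  simp only [Set.mem_insert_iff, Set.mem_singleton_iff] at hx hy
  rcases hx with rfl | rfl | rfl | rfl <;> rcases hy with rfl | rfl | rfl | rfl <;>
    first
    | exact absurd rfl hxy
    | simp [*, Ne.symm]

theorem finsum_coe_vertexSet_eq (hV : V(G) = {v₁, v₂, v₃, v₄}) (h₁₂ : v₁ ≠ v₂) (h₁₃ : v₁ ≠ v₃)
    (h₁₄ : v₁ ≠ v₄) (h₂₃ : v₂ ≠ v₃) (h₂₄ : v₂ ≠ v₄) (h₃₄ : v₃ ≠ v₄) (f : α → ℕ) :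
    ∑ᶠ v : V(G), f v = f v₁ + f v₂ + f v₃ + f v₄ := by
  classical
  rw [finsum_set_coe_eq_finsum_mem, hV,
    show ({v₁, v₂, v₃, v₄} : Set α) = (({v₁, v₂, v₃, v₄} : Finset α) : Set α) by simp,
    finsum_mem_coe_finset]
  simp [*, add_assoc]

end Graph

/-! ### Boundaries and orientations of four-vertex graphs -/

namespace Graph

variable {α β : Type*} {G : Graph α β} {v₁ v₂ v₃ v₄ : α} {ℓ : ℕ}

/-- `G` is a finite loopless graph on the four distinct vertices `v₁, v₂, v₃, v₄`. -/
structure IsFourVertex (G : Graph α β) (v₁ v₂ v₃ v₄ : α) : Prop where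
  loopless : G.Loopless
  finite : E(G).Finite
  vertexSet_eq : V(G) = {v₁, v₂, v₃, v₄}
  ne₁₂ : v₁ ≠ v₂
  ne₁₃ : v₁ ≠ v₃
  ne₁₄ : v₁ ≠ v₄
  ne₂₃ : v₂ ≠ v₃
  ne₂₄ : v₂ ≠ v₄
  ne₃₄ : v₃ ≠ v₄

namespace IsFourVertex

theorem forall_mem_iff (h : G.IsFourVertex v₁ v₂ v₃ v₄) {p : α → Prop} :
    (∀ v ∈ V(G), p v) ↔ p v₁ ∧ p v₂ ∧ p v₃ ∧ p v₄ := by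
  simp [h.vertexSet_eq]

theorem rotate (h : G.IsFourVertex v₁ v₂ v₃ v₄) : G.IsFourVertex v₂ v₃ v₄ v₁ where
  loopless := h.loopless
  finite := h.finite
  vertexSet_eq := by
    rw [h.vertexSet_eq]
    ext
    simp only [Set.mem_insert_iff, Set.mem_singleton_iff]
    tauto
  ne₁₂ := h.ne₂₃
  ne₁₃ := h.ne₂₄
  ne₁₄ := h.ne₁₂.symm
  ne₂₃ := h.ne₃₄
  ne₂₄ := h.ne₁₃.symm
  ne₃₄ := h.ne₁₄.symm

open Classical in
theorem ncard_setOf_isLink (h : G.IsFourVertex v₁ v₂ v₃ v₄) {Q : α → α → Prop}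
    (hQ : ∀ x y, Q x y ↔ Q y x) :
    {e | ∃ x y, Q x y ∧ G.IsLink e x y}.ncard =
      (if Q v₁ v₂ then G.edgeMult v₁ v₂ else 0) + (if Q v₁ v₃ then G.edgeMult v₁ v₃ else 0) +
      (if Q v₁ v₄ then G.edgeMult v₁ v₄ else 0) + (if Q v₂ v₃ then G.edgeMult v₂ v₃ else 0) +
      (if Q v₂ v₄ then G.edgeMult v₂ v₄ else 0) + (if Q v₃ v₄ then G.edgeMult v₃ v₄ else 0) :=
  have := h.loopless
  ncard_setOf_isLink_of_vertexSet_eq h.finite h.vertexSet_eq h.ne₁₂ h.ne₁₃ h.ne₁₄ h.ne₂₃ h.ne₂₄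
    h.ne₃₄ hQ

theorem ncard_edgeSet (h : G.IsFourVertex v₁ v₂ v₃ v₄) :
    E(G).ncard = G.edgeMult v₁ v₂ + G.edgeMult v₁ v₃ + G.edgeMult v₁ v₄ + G.edgeMult v₂ v₃ +
      G.edgeMult v₂ v₄ + G.edgeMult v₃ v₄ := by
  have := h.ncard_setOf_isLink (Q := fun _ _ ↦ True) (by simp)
  simpa [edgeSet_eq_setOfPred_exists_isLink] using this

theorem edgeMult_comm (G : Graph α β) (x y : α) : G.edgeMult x y = G.edgeMult y x := by
  simp only [edgeMult, G.isLink_comm (x := x)]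

theorem deg_fst (h : G.IsFourVertex v₁ v₂ v₃ v₄) :
    G.deg v₁ = G.edgeMult v₁ v₂ + G.edgeMult v₁ v₃ + G.edgeMult v₁ v₄ := by
  have := h.loopless
  have key := h.ncard_setOf_isLink (Q := fun x y ↦ x = v₁ ∨ y = v₁) (fun _ _ ↦ or_comm)
  have hs : G.incidenceSet v₁ = {e | ∃ x y, (x = v₁ ∨ y = v₁) ∧ G.IsLink e x y} := by
    ext e
    constructor
    · rintro ⟨y, hy⟩
      exact ⟨v₁, y, .inl rfl, hy⟩
    · rintro ⟨x, y, rfl | rfl, hl⟩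
      · exact hl.inc_left
      · exact hl.inc_right
  rw [deg_eq_ncard_incidenceSet, hs, key]
  simp [h.ne₁₂.symm, h.ne₁₃.symm, h.ne₁₄.symm]

theorem deg_eq (h : G.IsFourVertex v₁ v₂ v₃ v₄) :
    G.deg v₁ = G.edgeMult v₁ v₂ + G.edgeMult v₁ v₃ + G.edgeMult v₁ v₄ ∧
    G.deg v₂ = G.edgeMult v₁ v₂ + G.edgeMult v₂ v₃ + G.edgeMult v₂ v₄ ∧
    G.deg v₃ = G.edgeMult v₁ v₃ + G.edgeMult v₂ v₃ + G.edgeMult v₃ v₄ ∧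
    G.deg v₄ = G.edgeMult v₁ v₄ + G.edgeMult v₂ v₄ + G.edgeMult v₃ v₄ := by
  have h2 := h.rotate.deg_fst
  have h3 := h.rotate.rotate.deg_fst
  have h4 := h.rotate.rotate.rotate.deg_fst
  rw [edgeMult_comm G v₂ v₁] at h2
  rw [edgeMult_comm G v₃ v₁, edgeMult_comm G v₃ v₂] at h3
  rw [edgeMult_comm G v₄ v₁, edgeMult_comm G v₄ v₂, edgeMult_comm G v₄ v₃] at h4
  exact ⟨h.deg_fst, by omega, by omega, by omega⟩

open Classical in
theorem cutDeg_eq (h : G.IsFourVertex v₁ v₂ v₃ v₄) (S : Set α) :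
    G.cutDeg S =
      (if v₁ ∈ S ↔ v₂ ∉ S then G.edgeMult v₁ v₂ else 0) +
      (if v₁ ∈ S ↔ v₃ ∉ S then G.edgeMult v₁ v₃ else 0) +
      (if v₁ ∈ S ↔ v₄ ∉ S then G.edgeMult v₁ v₄ else 0) +
      (if v₂ ∈ S ↔ v₃ ∉ S then G.edgeMult v₂ v₃ else 0) +
      (if v₂ ∈ S ↔ v₄ ∉ S then G.edgeMult v₂ v₄ else 0) +
      (if v₃ ∈ S ↔ v₄ ∉ S then G.edgeMult v₃ v₄ else 0) := by
  have key := h.ncard_setOf_isLink (Q := fun x y ↦ (x ∈ S ↔ y ∉ S)) (fun _ _ ↦ by tauto)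
  have hs : {e | ∃ x ∈ S, ∃ y ∈ V(G) \ S, G.IsLink e x y} =
      {e | ∃ x y, (x ∈ S ↔ y ∉ S) ∧ G.IsLink e x y} := by
    ext e
    constructor
    · rintro ⟨x, hx, y, hy, hl⟩
      exact ⟨x, y, by simp [hx, hy.2], hl⟩
    · rintro ⟨x, y, hxy, hl⟩
      by_cases hx : x ∈ S
      · exact ⟨x, hx, y, ⟨hl.right_mem, hxy.1 hx⟩, hl⟩
      · exact ⟨y, by tauto, x, ⟨hl.left_mem, hx⟩, hl.symm⟩
  rw [cutDeg, hs]
  convert key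

theorem cutDeg_pair (h : G.IsFourVertex v₁ v₂ v₃ v₄) :
    G.cutDeg {v₁, v₂} =
      G.edgeMult v₁ v₃ + G.edgeMult v₁ v₄ + G.edgeMult v₂ v₃ + G.edgeMult v₂ v₄ ∧
    G.cutDeg {v₁, v₃} =
      G.edgeMult v₁ v₂ + G.edgeMult v₁ v₄ + G.edgeMult v₂ v₃ + G.edgeMult v₃ v₄ ∧
    G.cutDeg {v₁, v₄} =
      G.edgeMult v₁ v₂ + G.edgeMult v₁ v₃ + G.edgeMult v₂ v₄ + G.edgeMult v₃ v₄ := by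
  obtain ⟨_, _, _, n₁₂, n₁₃, n₁₄, n₂₃, n₂₄, n₃₄⟩ := id h
  refine ⟨?_, ?_, ?_⟩ <;> rw [h.cutDeg_eq] <;>
    simp [n₁₂.symm, n₁₃.symm, n₁₄.symm, n₂₃.symm, n₂₄.symm, n₃₄.symm, n₂₃, n₂₄, n₃₄]

/-- All two-element cuts have size `2 ℓ - 2` if and only if opposite multiplicities sum to
`ℓ - 1`. -/
theorem forall_cutDeg_eq_iff (h : G.IsFourVertex v₁ v₂ v₃ v₄) (hℓ : 1 ≤ ℓ)
    (hE : E(G).ncard = 3 * ℓ - 3) :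
    (∀ S : Set α, S ⊆ V(G) → S.ncard = 2 → G.cutDeg S = 2 * ℓ - 2) ↔
      G.edgeMult v₁ v₂ + G.edgeMult v₃ v₄ = ℓ - 1 ∧ G.edgeMult v₁ v₃ + G.edgeMult v₂ v₄ = ℓ - 1 ∧
        G.edgeMult v₁ v₄ + G.edgeMult v₂ v₃ = ℓ - 1 := by
  have hE' := h.ncard_edgeSet
  have hp := h.cutDeg_pair
  constructor
  · intro H
    -- A two-element cut misses exactly the edges of one opposite pair of multiplicities.
    have h₂ := H {v₁, v₂} (by simp [h.vertexSet_eq, Set.insert_subset_iff]) (Set.ncard_pair h.ne₁₂)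
    have h₃ := H {v₁, v₃} (by simp [h.vertexSet_eq, Set.insert_subset_iff]) (Set.ncard_pair h.ne₁₃)
    have h₄ := H {v₁, v₄} (by simp [h.vertexSet_eq, Set.insert_subset_iff]) (Set.ncard_pair h.ne₁₄)
    omega
  · intro H S hS hS2
    have hc := h.cutDeg_eq S
    obtain ⟨x, y, hxy, rfl⟩ := Set.ncard_eq_two.1 hS2
    obtain ⟨_, _, hV, n₁₂, n₁₃, n₁₄, n₂₃, n₂₄, n₃₄⟩ := id h
    have hx : x ∈ V(G) := hS (by simp)
    have hy : y ∈ V(G) := hS (by simp)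
    rw [hc]
    clear hc hS hS2 hp
    simp only [hV, Set.mem_insert_iff, Set.mem_singleton_iff] at hx hy
    rcases hx with rfl | rfl | rfl | rfl <;> rcases hy with rfl | rfl | rfl | rfl <;>
      first
      | exact absurd rfl hxy
      | simp [n₁₂.symm, n₁₃.symm, n₁₄.symm, n₂₃.symm, n₂₄.symm, n₃₄.symm, n₁₂, n₁₃, n₁₄, n₂₃,
          n₂₄, n₃₄]
        omega

theorem exists_edgeOrientation (h : G.IsFourVertex v₁ v₂ v₃ v₄) {l p₁ p₂ p₃ p₄ o₁ o₂ o₃ o₄ : ℤ}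
    (ho : IsOutDegrees l (G.edgeMult v₁ v₂) (G.edgeMult v₁ v₃) (G.edgeMult v₁ v₄)
      (G.edgeMult v₂ v₃) (G.edgeMult v₂ v₄) (G.edgeMult v₃ v₄) p₁ p₂ p₃ p₄ o₁ o₂ o₃ o₄) :
    ∃ D : G.EdgeOrientation, (D.outDeg v₁ : ℤ) = o₁ ∧ (D.outDeg v₂ : ℤ) = o₂ ∧
      (D.outDeg v₃ : ℤ) = o₃ ∧ (D.outDeg v₄ : ℤ) = o₄ := by
  classical
  obtain ⟨hs, ⟨h1, h2, h3, h4⟩, hpair, htriple, -⟩ := ho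
  lift o₁ to ℕ using h1
  lift o₂ to ℕ using h2
  lift o₃ to ℕ using h3
  lift o₄ to ℕ using h4
  obtain ⟨_, hfin, hV, n₁₂, n₁₃, n₁₄, n₂₃, n₂₄, n₃₄⟩ := id h
  have hE := h.ncard_edgeSet
  let o (v : α) : ℕ := if v = v₁ then o₁ else if v = v₂ then o₂ else if v = v₃ then o₃ else o₄
  have e1 : o v₁ = o₁ := by simp [o]
  have e2 : o v₂ = o₂ := by simp [o, n₁₂.symm]
  have e3 : o v₃ = o₃ := by simp [o, n₁₃.symm, n₂₃.symm]
  have e4 : o v₄ = o₄ := by simp [o, n₁₄.symm, n₂₄.symm, n₃₄.symm]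
  obtain ⟨D, hD⟩ := exists_edgeOrientation_outDeg_eq (G := G) {v₁, v₂, v₃, v₄} (by simp [hV]) hfin
    o (by simp [n₁₂, n₁₃, n₁₄, n₂₃, n₂₄, n₃₄, e1, e2, e3, e4]; omega) (by
      intro S hS
      have key := h.ncard_setOf_isLink (Q := fun x y ↦ x ∈ S ∧ y ∈ S) (fun _ _ ↦ and_comm)
      have hs : {e | ∃ x ∈ S, ∃ y ∈ S, G.IsLink e x y} =
          {e | ∃ x y, (x ∈ S ∧ y ∈ S) ∧ G.IsLink e x y} := by
        ext e
        simp only [Set.mem_ofPred_eq]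
        constructor
        · rintro ⟨x, hx, y, hy, hl⟩
          exact ⟨x, y, ⟨hx, hy⟩, hl⟩
        · rintro ⟨x, y, ⟨hx, hy⟩, hl⟩
          exact ⟨x, hx, y, hy, hl⟩
      have hS' : S = ({v₁, v₂, v₃, v₄} : Finset α).filter (· ∈ S) :=
        (Finset.inter_eq_right.2 hS).symm.trans (Finset.filter_mem_eq_inter ..).symm
      have hsum : ∑ v ∈ S, o v = (if v₁ ∈ S then o₁ else 0) + (if v₂ ∈ S then o₂ else 0) +
          (if v₃ ∈ S then o₃ else 0) + (if v₄ ∈ S then o₄ else 0) := by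
        conv_lhs => rw [hS', Finset.sum_filter]
        simp [-Finset.sum_ite_mem, n₁₂, n₁₃, n₁₄, n₂₃, n₂₄, n₃₄, e1, e2, e3, e4, add_assoc]
      rw [hs, key, hsum]
      -- For a triple `S`, Hakimi's condition is the bound of the remaining out-degree by its
      -- degree.
      by_cases m1 : v₁ ∈ S <;> by_cases m2 : v₂ ∈ S <;> by_cases m3 : v₃ ∈ S <;>
        by_cases m4 : v₄ ∈ S <;>
        simp only [m1, m2, m3, m4, and_self, and_true, and_false, if_true, if_false] <;> omega)
  exact ⟨D, by rw [hD _ (by simp), e1], by rw [hD _ (by simp), e2], by rw [hD _ (by simp), e3],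
    by rw [hD _ (by simp), e4]⟩

theorem realizes_iff (h : G.IsFourVertex v₁ v₂ v₃ v₄) (D : G.EdgeOrientation) {ℓ : ℕ} (f : α → ℕ)
    {b : V(G) → Fin (2 * ℓ)} (hb : ∀ v : V(G), (b v : ℕ) = f v) :
    D.Realizes b ↔
      2 * (D.outDeg v₁ : ℤ) - G.deg v₁ ≡ f v₁ [ZMOD 2 * ℓ] ∧
      2 * (D.outDeg v₂ : ℤ) - G.deg v₂ ≡ f v₂ [ZMOD 2 * ℓ] ∧
      2 * (D.outDeg v₃ : ℤ) - G.deg v₃ ≡ f v₃ [ZMOD 2 * ℓ] ∧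
      2 * (D.outDeg v₄ : ℤ) - G.deg v₄ ≡ f v₄ [ZMOD 2 * ℓ] := by
  have := h.loopless
  have e (v : α) : (D.outDeg v : ℤ) - D.inDeg v = 2 * D.outDeg v - G.deg v := by
    have := D.outDeg_add_inDeg h.finite v
    omega
  rw [← h.forall_mem_iff (p := fun v ↦ 2 * (D.outDeg v : ℤ) - G.deg v ≡ f v [ZMOD 2 * ℓ]),
    EdgeOrientation.Realizes, Subtype.forall]
  simp only [e, hb]

theorem isBoundary_iff (h : G.IsFourVertex v₁ v₂ v₃ v₄) {ℓ : ℕ} (f : α → ℕ)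
    {b : V(G) → Fin (2 * ℓ)} (hb : ∀ v : V(G), (b v : ℕ) = f v) :
    G.IsBoundary ℓ b ↔
      (f v₁ ≡ G.deg v₁ [MOD 2] ∧ f v₂ ≡ G.deg v₂ [MOD 2] ∧ f v₃ ≡ G.deg v₃ [MOD 2] ∧
        f v₄ ≡ G.deg v₄ [MOD 2]) ∧ f v₁ + f v₂ + f v₃ + f v₄ ≡ 0 [MOD 2 * ℓ] := by
  rw [← h.forall_mem_iff (p := fun v ↦ f v ≡ G.deg v [MOD 2]), IsBoundary, Subtype.forall]
  simp only [hb]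
  rw [finsum_coe_vertexSet_eq h.vertexSet_eq h.ne₁₂ h.ne₁₃ h.ne₁₄ h.ne₂₃ h.ne₂₄ h.ne₃₄]

theorem multiplicity_bounds (h : G.IsFourVertex v₁ v₂ v₃ v₄) (hμ : G.maxMult ≤ ℓ - 2) :
    G.edgeMult v₁ v₂ ≤ ℓ - 2 ∧ G.edgeMult v₁ v₃ ≤ ℓ - 2 ∧ G.edgeMult v₁ v₄ ≤ ℓ - 2 ∧
      G.edgeMult v₂ v₃ ≤ ℓ - 2 ∧ G.edgeMult v₂ v₄ ≤ ℓ - 2 ∧ G.edgeMult v₃ v₄ ≤ ℓ - 2 := by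
  obtain ⟨m₁, m₂, m₃, m₄⟩ := (h.forall_mem_iff (p := (· ∈ V(G)))).1 fun _ ↦ id
  exact ⟨(edgeMult_le_maxMult h.finite m₁ m₂ h.ne₁₂).trans hμ,
    (edgeMult_le_maxMult h.finite m₁ m₃ h.ne₁₃).trans hμ,
    (edgeMult_le_maxMult h.finite m₁ m₄ h.ne₁₄).trans hμ,
    (edgeMult_le_maxMult h.finite m₂ m₃ h.ne₂₃).trans hμ,
    (edgeMult_le_maxMult h.finite m₂ m₄ h.ne₂₄).trans hμ,
    (edgeMult_le_maxMult h.finite m₃ m₄ h.ne₃₄).trans hμ⟩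

theorem exists_isOutDegrees_or_opposite (h : G.IsFourVertex v₁ v₂ v₃ v₄) (hℓ : 3 ≤ ℓ)
    (hE : E(G).ncard = 3 * ℓ - 3) (hμ : G.maxMult ≤ ℓ - 2) (hδ : ℓ - 1 ≤ G.minDeg)
    {p₁ p₂ p₃ p₄ : ℤ} (hs : (ℓ : ℤ) ∣ p₁ + p₂ + p₃ + p₄ + 3) :
    (∃ o₁ o₂ o₃ o₄, IsOutDegrees ℓ (G.edgeMult v₁ v₂) (G.edgeMult v₁ v₃) (G.edgeMult v₁ v₄)
        (G.edgeMult v₂ v₃) (G.edgeMult v₂ v₄) (G.edgeMult v₃ v₄) p₁ p₂ p₃ p₄ o₁ o₂ o₃ o₄) ∨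
      (G.edgeMult v₁ v₂ + G.edgeMult v₃ v₄ = ℓ - 1 ∧
        G.edgeMult v₁ v₃ + G.edgeMult v₂ v₄ = ℓ - 1 ∧
        G.edgeMult v₁ v₄ + G.edgeMult v₂ v₃ = ℓ - 1) ∧
      2 * p₁ ≡ G.deg v₁ - ℓ [ZMOD 2 * ℓ] ∧ 2 * p₂ ≡ G.deg v₂ - ℓ [ZMOD 2 * ℓ] ∧
      2 * p₃ ≡ G.deg v₃ - ℓ [ZMOD 2 * ℓ] ∧ 2 * p₄ ≡ G.deg v₄ - ℓ [ZMOD 2 * ℓ] := by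
  obtain ⟨δ₁, δ₂, δ₃, δ₄⟩ := (h.forall_mem_iff (p := fun v ↦ ℓ - 1 ≤ G.deg v)).1
    fun v hv ↦ hδ.trans (minDeg_le_deg hv)
  obtain ⟨μ₁₂, μ₁₃, μ₁₄, μ₂₃, μ₂₄, μ₃₄⟩ := h.multiplicity_bounds hμ
  obtain ⟨d₁, d₂, d₃, d₄⟩ := h.deg_eq
  have hE' := h.ncard_edgeSet
  rw [hE] at hE'
  have bound {m : ℕ} (hm : m ≤ ℓ - 2) : (m : ℤ) ≤ ℓ - 2 := by omega
  have degree {d a b c : ℕ} (hd : ℓ - 1 ≤ d) (he : d = a + b + c) : (ℓ : ℤ) - 1 ≤ a + b + c := by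
    omega
  refine (exists_isOutDegrees_or (by exact_mod_cast hℓ)
    (by refine ⟨?_, ?_, ?_, ?_, ?_, ?_⟩ <;> exact Int.natCast_nonneg _)
    ⟨bound μ₁₂, bound μ₁₃, bound μ₁₄, bound μ₂₃, bound μ₂₄, bound μ₃₄⟩
    (by clear δ₁ δ₂ δ₃ δ₄ μ₁₂ μ₁₃ μ₁₄ μ₂₃ μ₂₄ μ₃₄ d₁ d₂ d₃ d₄; omega)
    ⟨degree δ₁ d₁, degree δ₂ d₂, degree δ₃ d₃, degree δ₄ d₄⟩ hs).imp_right ?_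
  rintro ⟨s₁, s₂, s₃, r⟩
  have opposite {a b : ℕ} (hab : (a : ℤ) + b = ℓ - 1) : a + b = ℓ - 1 := by omega
  refine ⟨⟨opposite s₁, opposite s₂, opposite s₃⟩, ?_⟩
  rw [d₁, d₂, d₃, d₄]
  exact_mod_cast r

/-- A boundary without orientation is constantly `ℓ`, and opposite multiplicities sum to
`ℓ - 1`. -/
theorem eq_of_not_exists_realizes (h : G.IsFourVertex v₁ v₂ v₃ v₄) (hℓ : 3 ≤ ℓ)
    (hE : E(G).ncard = 3 * ℓ - 3) (hμ : G.maxMult ≤ ℓ - 2) (hδ : ℓ - 1 ≤ G.minDeg)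
    {b : V(G) → Fin (2 * ℓ)} (hb : G.IsBoundary ℓ b)
    (hD : ¬ ∃ D : G.EdgeOrientation, D.Realizes b) :
    (G.edgeMult v₁ v₂ + G.edgeMult v₃ v₄ = ℓ - 1 ∧ G.edgeMult v₁ v₃ + G.edgeMult v₂ v₄ = ℓ - 1 ∧
        G.edgeMult v₁ v₄ + G.edgeMult v₂ v₃ = ℓ - 1) ∧
      ∀ v : V(G), (b v : ℕ) = ℓ := by
  classical
  let f (v : α) : ℕ := if hv : v ∈ V(G) then b ⟨v, hv⟩ else 0
  have hf : ∀ v : V(G), (b v : ℕ) = f v := fun v ↦ by simp [f]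
  have hlt : ∀ v ∈ V(G), f v < 2 * ℓ := fun v hv ↦ by simp [f, hv]
  obtain ⟨l₁, l₂, l₃, l₄⟩ := h.forall_mem_iff.1 hlt
  obtain ⟨⟨c₁, c₂, c₃, c₄⟩, hsum⟩ := (h.isBoundary_iff f hf).1 hb
  -- Parity makes `(β(v) + d(v)) / 2` an integer, the required out-degree modulo `ℓ`.
  have half {n d : ℕ} (hnd : n ≡ d [MOD 2]) : ∃ p : ℤ, 2 * p = n + d :=
    ⟨(n + d) / 2, by unfold Nat.ModEq at hnd; omega⟩
  obtain ⟨p₁, hp₁⟩ := half c₁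
  obtain ⟨p₂, hp₂⟩ := half c₂
  obtain ⟨p₃, hp₃⟩ := half c₃
  obtain ⟨p₄, hp₄⟩ := half c₄
  have hdvd : (ℓ : ℤ) ∣ p₁ + p₂ + p₃ + p₄ + 3 := by
    obtain ⟨k, hk⟩ := (Nat.modEq_zero_iff_dvd).1 hsum
    refine ⟨k + 3, ?_⟩
    have : ((f v₁ + f v₂ + f v₃ + f v₄ : ℕ) : ℤ) = 2 * (ℓ * k) := by rw [hk]; push_cast; ring
    -- By the handshake identity the `p`'s sum to `ℓ k + 3 ℓ - 3`.
    have hE' : (G.deg v₁ : ℤ) + G.deg v₂ + G.deg v₃ + G.deg v₄ = 2 * (3 * ℓ - 3) := by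
      obtain ⟨d₁, d₂, d₃, d₄⟩ := h.deg_eq
      have := h.ncard_edgeSet
      omega
    push_cast at this
    linarith
  obtain ⟨o₁, o₂, o₃, o₄, ho⟩ | ⟨hopp, r₁, r₂, r₃, r₄⟩ :=
    h.exists_isOutDegrees_or_opposite hℓ hE hμ hδ hdvd
  · refine absurd ?_ hD
    obtain ⟨D, rfl, rfl, rfl, rfl⟩ := h.exists_edgeOrientation ho
    obtain ⟨-, -, -, -, r₁, r₂, r₃, r₄⟩ := ho
    refine ⟨D, (h.realizes_iff D f hf).2 ?_⟩
    have aux {o p : ℤ} {n d : ℕ} (r : o ≡ p [ZMOD ℓ]) (hp : 2 * p = n + d) :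
        2 * o - d ≡ n [ZMOD 2 * ℓ] := by
      have := (r.mul_left' (c := 2)).sub_right (d : ℤ)
      rwa [hp, add_sub_cancel_right] at this
    exact ⟨aux r₁ hp₁, aux r₂ hp₂, aux r₃ hp₃, aux r₄ hp₄⟩
  · refine ⟨hopp, ?_⟩
    -- Cancelling `d` leaves `n ≡ -ℓ` modulo `2ℓ`, and `0 ≤ n < 2ℓ` singles out `n = ℓ`.
    have aux {p : ℤ} {n d : ℕ} (r : 2 * p ≡ d - ℓ [ZMOD 2 * ℓ]) (hp : 2 * p = n + d)
        (hn : n < 2 * ℓ) : n = ℓ := by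
      obtain ⟨k, hk⟩ := r.symm.dvd
      have hk' : (n : ℤ) + ℓ = 2 * (ℓ * k) := by rw [← mul_assoc]; omega
      have h0 : 0 < k := by
        by_contra! hk0
        have := mul_nonpos_of_nonneg_of_nonpos (show (0 : ℤ) ≤ ℓ by omega) hk0
        omega
      have h1 : k < 2 := by
        by_contra! hk0
        have := mul_le_mul_of_nonneg_left hk0 (show (0 : ℤ) ≤ ℓ by omega)
        omega
      obtain rfl : k = 1 := by omega
      omega
    rw [Subtype.forall]
    simp only [hf]
    rw [h.forall_mem_iff (p := fun v ↦ f v = ℓ)]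
    exact ⟨aux r₁ hp₁ l₁, aux r₂ hp₂ l₂,
      aux r₃ hp₃ l₃, aux r₄ hp₄ l₄⟩

theorem not_exists_realizes (h : G.IsFourVertex v₁ v₂ v₃ v₄) (hℓ : 3 ≤ ℓ)
    (hμ : G.maxMult ≤ ℓ - 2)
    (hopp : G.edgeMult v₁ v₂ + G.edgeMult v₃ v₄ = ℓ - 1 ∧
      G.edgeMult v₁ v₃ + G.edgeMult v₂ v₄ = ℓ - 1 ∧ G.edgeMult v₁ v₄ + G.edgeMult v₂ v₃ = ℓ - 1)
    {b : V(G) → Fin (2 * ℓ)} (hb : ∀ v : V(G), (b v : ℕ) = ℓ) :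
    ¬ ∃ D : G.EdgeOrientation, D.Realizes b := by
  classical
  rintro ⟨D, hD⟩
  obtain ⟨r₁, r₂, r₃, r₄⟩ := (h.realizes_iff D (fun _ ↦ ℓ) hb).1 hD
  obtain ⟨d₁, d₂, d₃, d₄⟩ := h.deg_eq
  obtain ⟨μ₁₂, μ₁₃, μ₁₄, μ₂₃, μ₂₄, μ₃₄⟩ := h.multiplicity_bounds hμ
  obtain ⟨s₁, s₂, s₃⟩ := hopp
  have hsum := D.sum_outDeg {v₁, v₂, v₃, v₄} (by simp [h.vertexSet_eq]) h.finite
  simp only [Finset.sum_insert, Finset.sum_singleton, Finset.mem_insert, Finset.mem_singleton,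
    h.ne₁₂, h.ne₁₃, h.ne₁₄, h.ne₂₃, h.ne₂₄, h.ne₃₄, or_self, not_false_eq_true,
    h.ncard_edgeSet, ← add_assoc] at hsum
  have := h.loopless
  have hle (v : α) : D.outDeg v ≤ G.deg v :=
    D.outDeg_add_inDeg h.finite v ▸ Nat.le_add_right _ _
  have e₁ := hle v₁
  have e₂ := hle v₂
  have e₃ := hle v₃
  have e₄ := hle v₄
  have hmul := D.edgeMult_le_outDeg_add_outDeg h.finite
  rw [d₁] at r₁ e₁
  rw [d₂] at r₂ e₂
  rw [d₃] at r₃ e₃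
  rw [d₄] at r₄ e₄
  push_cast at r₁ r₂ r₃ r₄
  have bound {m : ℕ} (hm : m ≤ ℓ - 2) : (m : ℤ) ≤ ℓ - 2 := by clear * - hℓ hm; omega
  have opposite {a b : ℕ} (hab : a + b = ℓ - 1) : (a : ℤ) + b = ℓ - 1 := by
    clear * - hℓ hab
    omega
  exact not_outDegrees_of_opposite_sum (l := ℓ) (by exact_mod_cast hℓ)
    ⟨bound μ₁₂, bound μ₁₃, bound μ₁₄, bound μ₂₃, bound μ₂₄, bound μ₃₄⟩
    ⟨opposite s₁, opposite s₂, opposite s₃⟩ (by exact_mod_cast hsum)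
    (by refine ⟨?_, ?_, ?_, ?_⟩ <;> exact Int.natCast_nonneg _)
    (by refine ⟨?_, ?_, ?_, ?_, ?_, ?_⟩ <;> exact_mod_cast hmul _ _)
    ⟨by exact_mod_cast e₁, by exact_mod_cast e₂, by exact_mod_cast e₃, by exact_mod_cast e₄⟩
    r₁ r₂ r₃ r₄

theorem isBoundary_of_eq (h : G.IsFourVertex v₁ v₂ v₃ v₄)
    (hdeg : ∀ v ∈ V(G), G.deg v ≡ ℓ [MOD 2]) {b : V(G) → Fin (2 * ℓ)}
    (hb : ∀ v : V(G), (b v : ℕ) = ℓ) : G.IsBoundary ℓ b := by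
  rw [h.isBoundary_iff (fun _ ↦ ℓ) hb]
  obtain ⟨c₁, c₂, c₃, c₄⟩ := h.forall_mem_iff.1 hdeg
  exact ⟨⟨c₁.symm, c₂.symm, c₃.symm, c₄.symm⟩, Nat.modEq_zero_iff_dvd.2 ⟨2, by ring⟩⟩

end IsFourVertex

theorem exists_isFourVertex (hG : G.Loopless) (hE : E(G).Finite) (hV : V(G).ncard = 4) :
    ∃ v₁ v₂ v₃ v₄, G.IsFourVertex v₁ v₂ v₃ v₄ := by
  classical
  have hfin : V(G).Finite := Set.finite_of_ncard_ne_zero (by omega)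
  rw [Set.ncard_eq_toFinset_card _ hfin, Finset.card_eq_four] at hV
  obtain ⟨v₁, v₂, v₃, v₄, h₁₂, h₁₃, h₁₄, h₂₃, h₂₄, h₃₄, hV⟩ := hV
  refine ⟨v₁, v₂, v₃, v₄, hG, hE, ?_, h₁₂, h₁₃, h₁₄, h₂₃, h₂₄, h₃₄⟩
  rw [← hfin.coe_toFinset, hV]
  simp

end Graph

/-! ### The characterization -/

theorem mainTheorem1 {α β : Type*} (G : Graph α β) (hloopless : G.Loopless)
    (ℓ : ℕ) (hℓ : 3 ≤ ℓ)
    (hV : V(G).ncard = 4) (hE : E(G).ncard = 3 * ℓ - 3)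
    (hμ : G.maxMult ≤ ℓ - 2) (hδ : ℓ - 1 ≤ G.minDeg) :
    (¬ G.StronglyConnectedMod ℓ ↔
      (∀ S : Set α, S ⊆ V(G) → S.ncard = 2 → G.cutDeg S = 2 * ℓ - 2) ∧
        (∀ v ∈ V(G), G.deg v ≡ ℓ [MOD 2])) ∧
    (¬ G.StronglyConnectedMod ℓ →
      ∀ b : V(G) → Fin (2 * ℓ),
        (G.IsBoundary ℓ b ∧ ¬ ∃ D : G.EdgeOrientation, D.Realizes b) ↔
          ∀ v : V(G), (b v : ℕ) = ℓ) := by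
  -- The edge set is finite because an infinite set has `ncard` zero, while `3 ℓ - 3 > 0`.
  obtain ⟨v₁, v₂, v₃, v₄, h⟩ := Graph.exists_isFourVertex hloopless
    (Set.finite_of_ncard_ne_zero (by omega)) hV
  rw [h.forall_cutDeg_eq_iff (by omega) hE]
  have exceptional (hsc : ¬ G.StronglyConnectedMod ℓ) :
      (G.edgeMult v₁ v₂ + G.edgeMult v₃ v₄ = ℓ - 1 ∧ G.edgeMult v₁ v₃ + G.edgeMult v₂ v₄ = ℓ - 1 ∧
        G.edgeMult v₁ v₄ + G.edgeMult v₂ v₃ = ℓ - 1) ∧ ∀ v ∈ V(G), G.deg v ≡ ℓ [MOD 2] := by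
    simp only [Graph.StronglyConnectedMod, not_forall] at hsc
    obtain ⟨b, hb, hD⟩ := hsc
    obtain ⟨hopp, hbℓ⟩ := h.eq_of_not_exists_realizes hℓ hE hμ hδ hb hD
    exact ⟨hopp, fun v hv ↦ hbℓ ⟨v, hv⟩ ▸ (hb.1 ⟨v, hv⟩).symm⟩
  refine ⟨⟨exceptional, fun ⟨hopp, hdeg⟩ hsc ↦ ?_⟩, fun hsc b ↦ ⟨fun ⟨hb, hD⟩ ↦ ?_, fun hb ↦ ?_⟩⟩
  · exact h.not_exists_realizes hℓ hμ hopp (b := fun _ ↦ ⟨ℓ, by omega⟩) (fun _ ↦ rfl)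
      (hsc _ (h.isBoundary_of_eq hdeg fun _ ↦ rfl))
  · exact (h.eq_of_not_exists_realizes hℓ hE hμ hδ hb hD).2
  · obtain ⟨hopp, hdeg⟩ := exceptional hsc
    exact ⟨h.isBoundary_of_eq hdeg hb, h.not_exists_realizes hℓ hμ hopp hb⟩
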